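/- Let $G$ be a finite connected chordal graph with vertex set $V$ (chordal: every cycle of length at least $4$ has a chord). Let $\mathcal C$ be the set of its (inclusion-)maximal cliques, regarded as subsets of $V$, and let $K=|\mathcal C|$. A clique tree of $G$ is a tree $T=(\mathcal C,\mathcal E)$ with vertex set $\mathcal C$ such that for all $C_1,C_2\in\mathcal C$ and every $C_3\in\mathcal C$ on the path in $T$ between $C_1$ and $C_2$ one has $C_1\cap C_2\subseteq C_3$. Let $\mathcal T$ be the set of clique trees of $G$. For an enumeration $\pi=(C_{\pi(1)},\dots,C_{\pi(K)})$ of $\mathcal C$ (each maximal clique listed exactly once) put $S_{\pi(k)}=(C_{\pi(1)}\cup\dots\cup C_{\pi(k-1)})\cap C_{\pi(k)}$ for $2\le k\le K$. The enumeration $\pi$ is a perfect sequence if for every $k\ge 2$ the set $S_{\pi(k)}$ is a clique and $S_{\pi(k)}\subsetneq C_{\pi(k')}$ for some $k'<k$. Let $\Pi$ be the set of perfect sequences of $G$. A tree $T\in\mathcal T$ can be produced from $\pi\in\Pi$ by Lauritzen's construction if one can choose, for each $k=2,\dots,K$, an index $k'=k'(k)<k$ with $S_{\pi(k)}=C_{\pi(k')}\cap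 C_{\pi(k)}$ such that the edge set of $T$ is $\{\{C_{\pi(k)},C_{\pi(k'(k))}\} : 2\le k\le K\}$. Let $B$ be the bipartite graph with vertex classes $\mathcal T$ and $\Pi$ in which $T\in\mathcal T$ and $\pi\in\Pi$ are adjacent if and only if $T$ can be produced from $\pi$ by Lauritzen's construction. Then $B$ is connected (in particular non-empty). Moreover, $T\in\mathcal T$ and $\pi\in\Pi$ are adjacent in $B$ if and only if $\pi$ is a topological order of $T$ rooted at $C_{\pi(1)}$, that is, when all edges of $T$ are directed away from $C_{\pi(1)}$, $C_a$ precedes $C_b$ in $\pi$ whenever there is a directed path of positive length from $C_a$ to $C_b$. -/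

import Mathlib

namespace ChordalCliques

variable {V : Type*}

/-- A graph is chordal if every cycle of length at least four has a chord, that is, an edge of
the graph joining two vertices of the cycle which is not itself an edge of the cycle. -/
def IsChordal (G : SimpleGraph V) : Prop :=
  ∀ ⦃v : V⦄ (c : G.Walk v v), c.IsCycle → 4 ≤ c.length →
    ∃ x ∈ c.support, ∃ y ∈ c.support, G.Adj x y ∧ s(x, y) ∉ c.edges

/-- The type of (inclusion-)maximal cliques of `G`, a clique being regarded as a vertex set. -/
abbrev MaximalClique (G : SimpleGraph V) : Type _ :=
  {C : Set V // Maximal G.IsClique C}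

/-- A tree on the maximal cliques with the junction property: if `C₃` lies on the path
of `T` between `C₁` and `C₂`, then `C₁ ∩ C₂ ⊆ C₃`. -/
structure IsCliqueTree (G : SimpleGraph V) (T : SimpleGraph (MaximalClique G)) : Prop where
  isTree : T.IsTree
  junction : ∀ (C₁ C₂ : MaximalClique G) (p : T.Walk C₁ C₂), p.IsPath →
    ∀ C₃ ∈ p.support, C₁.1 ∩ C₂.1 ⊆ C₃.1

/-- The set of all clique trees of `G`. -/
abbrev CliqueTree (G : SimpleGraph V) : Type _ :=
  {T : SimpleGraph (MaximalClique G) // IsCliqueTree G T}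

/-- An ordering of the maximal cliques: a sequence listing each of them exactly once.
Positions are numbered from `0`. -/
abbrev CliqueOrdering (G : SimpleGraph V) : Type _ :=
  Fin (Nat.card (MaximalClique G)) ≃ MaximalClique G

/-- The intersection of the `k`-th clique of the sequence with the union of the earlier ones. -/
def separator {G : SimpleGraph V} (π : CliqueOrdering G)
    (k : Fin (Nat.card (MaximalClique G))) : Set V :=
  (⋃ j, ⋃ (_ : j < k), (π j).1) ∩ (π k).1

/-- The running intersection property. -/
def IsPerfect {G : SimpleGraph V} (π : CliqueOrdering G) : Prop :=
  ∀ k : Fin (Nat.card (MaximalClique G)), 0 < k.val →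
    G.IsClique (separator π k) ∧ ∃ k' < k, separator π k ⊂ (π k').1

/-- The set of all perfect sequences of maximal cliques of `G`. -/
abbrev PerfectSequence (G : SimpleGraph V) : Type _ :=
  {π : CliqueOrdering G // IsPerfect π}

/-- `T` is a possible output of Lauritzen's construction on input `π`: for every position `k`
except the first one, an earlier position `f k` is chosen whose clique meets the `k`-th clique
exactly in `separator π k`; the edges of `T` are the pairs of the `k`-th and the `f k`-th clique. -/
def TreeFromSequence {G : SimpleGraph V} (π : CliqueOrdering G)
    (T : SimpleGraph (MaximalClique G)) : Prop :=
  ∃ f : Fin (Nat.card (MaximalClique G)) → Fin (Nat.card (MaximalClique G)),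
    (∀ k, 0 < k.val → f k < k ∧ separator π k = (π (f k)).1 ∩ (π k).1) ∧
    T.edgeSet = {e | ∃ k, 0 < k.val ∧ e = s(π k, π (f k))}

/-- The edges of a tree `T`, directed away from the root `r`. -/
def DirectedEdge {W : Type*} (T : SimpleGraph W) (r a b : W) : Prop :=
  T.Adj a b ∧ T.dist r b = T.dist r a + 1

/-- `π` is a topological order of `T` rooted at the first clique of `π`: whenever there is a
directed path from `a` to `b`, the clique `a` comes before `b`. -/
def IsTopologicalOrder {G : SimpleGraph V} (T : SimpleGraph (MaximalClique G))
    (π : CliqueOrdering G) : Prop :=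
  ∃ k₀ : Fin (Nat.card (MaximalClique G)), k₀.val = 0 ∧
    ∀ a b : MaximalClique G, Relation.TransGen (DirectedEdge T (π k₀)) a b →
      π.symm a < π.symm b

/-- The bipartite graph whose two vertex classes are the clique trees and the perfect sequences
of `G`; a clique tree `T` and a perfect sequence `π` are adjacent if `T` can be produced
from `π` by Lauritzen's construction. -/
def bipartiteGraph (G : SimpleGraph V) : SimpleGraph (CliqueTree G ⊕ PerfectSequence G) where
  Adj x y := match x, y with
    | .inl T, .inr π => TreeFromSequence π.1 T.1
    | .inr π, .inl T => TreeFromSequence π.1 T.1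
    | _, _ => False
  symm := ⟨by rintro (_ | _) (_ | _) h <;> exact h⟩
  loopless := ⟨by rintro (_ | _) h <;> exact h⟩

end ChordalCliques

/-! A choice of parents `f k < k` always spans a tree in which edges point from `f k` to `k`, so a
tree produced from `π` has `π` as a topological order. Conversely, in a topological order the path
from any earlier clique to `π k` enters through the parent of `π k`; the junction property then puts
`separator π k` inside that parent (`IsCliqueTree.treeFromSequence`).

Every perfect sequence has a neighbouring clique tree, so for connectedness it suffices to link any
two clique trees `T`, `T'`. Given an edge `A'B'` of `T'` outside `T`, the `T`-path from `A'` to `B'`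
crosses the cut of `T' - A'B'` in some edge `AB`. Replacing `AB` by `A'B` and then by `A'B'` moves
one end at a time, and each move stays within the trees produced from one sequence
(`exists_cliqueTree_move_edge`). The number of edges of `T'` missing from `T` drops.

Non-emptiness is where chordality enters: Dirac's simplicial vertices allow a perfect sequence to be
built by adding one vertex at a time. -/

namespace ChordalCliques

/-! ### Trees given by a parent function on an ordered vertex set -/

section ParentFunction

variable {W : Type*} {n : ℕ}

/-- The graph whose edges join the `k`-th element to the `f k`-th one, for every `k` except the
first one. -/
def parentGraph (e : Fin n ≃ W) (f : Fin n → Fin n) : SimpleGraph W :=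
  SimpleGraph.fromEdgeSet {x | ∃ k, 0 < k.val ∧ x = s(e k, e (f k))}

theorem edgeSet_parentGraph (e : Fin n ≃ W) {f : Fin n → Fin n}
    (hf : ∀ k, 0 < k.val → f k < k) :
    (parentGraph e f).edgeSet = {x | ∃ k, 0 < k.val ∧ x = s(e k, e (f k))} := by
  rw [parentGraph, SimpleGraph.edgeSet_fromEdgeSet, sdiff_eq_left, Set.disjoint_left]
  rintro _ ⟨k, hk, rfl⟩ h
  have : e k = e (f k) := by simpa using h
  exact (hf k hk).ne' (e.injective this)

theorem parentGraph_adj (e : Fin n ≃ W) {f : Fin n → Fin n}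
    (hf : ∀ k, 0 < k.val → f k < k) {k : Fin n} (hk : 0 < k.val) :
    (parentGraph e f).Adj (e k) (e (f k)) := by
  rw [← SimpleGraph.mem_edgeSet, edgeSet_parentGraph e hf]
  exact ⟨k, hk, rfl⟩

theorem exists_walk_from_first {e : Fin n ≃ W} {f : Fin n → Fin n} {T : SimpleGraph W}
    (hf : ∀ k, 0 < k.val → f k < k) (hT : ∀ k, 0 < k.val → T.Adj (e k) (e (f k)))
    {k₀ : Fin n} (h₀ : k₀.val = 0) (k : Fin n) :
    ∃ p : T.Walk (e k₀) (e k), ∀ x ∈ p.support, e.symm x ≤ k := by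
  induction k using WellFoundedLT.induction with
  | ind k ih =>
    rcases Nat.eq_zero_or_pos k.val with hk | hk
    · obtain rfl : k₀ = k := Fin.ext (h₀.trans hk.symm)
      exact ⟨.nil, by simp⟩
    · obtain ⟨p, hp⟩ := ih _ (hf k hk)
      refine ⟨p.concat (hT k hk).symm, fun x hx => ?_⟩
      rw [SimpleGraph.Walk.support_concat, List.mem_append] at hx
      rcases hx with hx | hx
      · exact (hp x hx).trans (hf k hk).le
      · simp_all

/-- Going from `e j` back to the first element and then out to `e (f k)` meets only positions below
`k`. -/
theorem exists_path_to_parent {e : Fin n ≃ W} {f : Fin n → Fin n} {T : SimpleGraph W}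
    (hf : ∀ k, 0 < k.val → f k < k) (hT : ∀ k, 0 < k.val → T.Adj (e k) (e (f k)))
    {j k : Fin n} (hjk : j < k) :
    ∃ p : T.Walk (e j) (e (f k)), p.IsPath ∧ e k ∉ p.support := by
  classical
  have hk : 0 < k.val := (Nat.zero_le _).trans_lt (Fin.lt_def.1 hjk)
  let k₀ : Fin n := ⟨0, hk.trans k.2⟩
  obtain ⟨p, hp⟩ := exists_walk_from_first hf hT (k₀ := k₀) rfl j
  obtain ⟨q, hq⟩ := exists_walk_from_first hf hT (k₀ := k₀) rfl (f k)
  refine ⟨(p.reverse.append q).bypass, SimpleGraph.Walk.bypass_isPath _, fun h => ?_⟩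
  have h := SimpleGraph.Walk.support_bypass_subset_support _ h
  rw [SimpleGraph.Walk.mem_support_append_iff, SimpleGraph.Walk.support_reverse,
    List.mem_reverse] at h
  rcases h with h | h
  · exact (hp _ h).not_gt (by simpa using hjk)
  · exact (hq _ h).not_gt (by simpa using hf k hk)

theorem connected_of_parent {e : Fin n ≃ W} {f : Fin n → Fin n} {T : SimpleGraph W} (hn : 0 < n)
    (hf : ∀ k, 0 < k.val → f k < k) (hT : ∀ k, 0 < k.val → T.Adj (e k) (e (f k))) :
    T.Connected := by
  let k₀ : Fin n := ⟨0, hn⟩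
  have h : ∀ x, T.Reachable (e k₀) x := fun x => by
    obtain ⟨p, -⟩ := exists_walk_from_first hf hT (k₀ := k₀) rfl (e.symm x)
    exact ⟨p.copy rfl (e.apply_symm_apply x)⟩
  exact { preconnected := fun x y => (h x).symm.trans (h y), nonempty := ⟨e k₀⟩ }

theorem isTree_parentGraph (e : Fin n ≃ W) {f : Fin n → Fin n} (hn : 0 < n)
    (hf : ∀ k, 0 < k.val → f k < k) : (parentGraph e f).IsTree := by
  have hW : Finite W := Finite.of_equiv _ e
  have hc : (parentGraph e f).Connected :=
    connected_of_parent hn hf fun k hk => parentGraph_adj e hf hk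
  refine SimpleGraph.isTree_iff_connected_and_card.2
    ⟨hc, le_antisymm ?_ hc.card_vert_le_card_edgeSet_add_one⟩
  have hcard : Nat.card W = n := by rw [Nat.card_congr e.symm, Nat.card_fin]
  -- Position `0` contributes no edge, so a connected graph on `n` vertices has at most `n - 1`
  -- edges.
  have hset : {x | ∃ k : Fin n, 0 < k.val ∧ x = s(e k, e (f k))} =
      (fun k => s(e k, e (f k))) '' ({⟨0, hn⟩}ᶜ : Set (Fin n)) := by
    ext x
    simp only [Set.mem_ofPred_eq, Set.mem_image, Set.mem_compl_iff, Set.mem_singleton_iff,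
      Fin.ext_iff, Nat.pos_iff_ne_zero, eq_comm]
  have hle : Nat.card (parentGraph e f).edgeSet ≤ n - 1 := by
    rw [edgeSet_parentGraph e hf, hset, Nat.card_coe_set_eq]
    refine (Set.ncard_image_le (Set.toFinite _)).trans ?_
    rw [Set.ncard_compl, Set.ncard_singleton, Nat.card_fin]
  omega

theorem IsTree.eq_of_le {T T' : SimpleGraph W} (h : T ≤ T') (hT : T.IsTree) (hT' : T'.IsTree) :
    T = T' :=
  le_antisymm h ((SimpleGraph.isTree_iff_minimal_connected.1 hT').2 hT.connected h)

theorem IsTree.length_eq_dist {T : SimpleGraph W} (hT : T.IsTree) {x y : W} {p : T.Walk x y}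
    (hp : p.IsPath) : p.length = T.dist x y := by
  obtain ⟨q, hq, hql⟩ := hT.connected.exists_path_of_dist x y
  rw [← hql, (hT.existsUnique_path x y).unique hp hq]

theorem dist_eq_dist_parent_add_one {e : Fin n ≃ W} {f : Fin n → Fin n} {T : SimpleGraph W}
    (hT : T.IsTree) (hf : ∀ k, 0 < k.val → f k < k)
    (hadj : ∀ k, 0 < k.val → T.Adj (e k) (e (f k))) {j k : Fin n} (hjk : j < k) :
    T.dist (e j) (e k) = T.dist (e j) (e (f k)) + 1 := by
  obtain ⟨p, hp, hkp⟩ := exists_path_to_parent hf hadj hjk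
  have hk : 0 < k.val := (Nat.zero_le _).trans_lt (Fin.lt_def.1 hjk)
  rw [← IsTree.length_eq_dist hT hp, ← IsTree.length_eq_dist hT (hp.concat hkp (hadj k hk).symm),
    SimpleGraph.Walk.length_concat]

theorem exists_equiv_monotone {α : Type*} [LinearOrder α] [Finite W] (key : W → α) :
    ∃ e : Fin (Nat.card W) ≃ W, ∀ a b, key a < key b → e.symm a < e.symm b := by
  let e₀ := (Finite.equivFin W).symm
  let e := (Tuple.sort (key ∘ e₀)).trans e₀
  have hm : Monotone (key ∘ e) := Tuple.monotone_sort (key ∘ e₀)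
  refine ⟨e, fun a b hab => lt_of_not_ge fun h => hab.not_ge ?_⟩
  simpa using hm h

theorem exists_directedEdge {T : SimpleGraph W} (hT : T.Connected) {r b : W} (h : b ≠ r) :
    ∃ a, DirectedEdge T r a b := by
  obtain ⟨p, hp⟩ := hT.exists_walk_length_eq_dist b r
  cases p with
  | nil => exact absurd rfl h
  | @cons _ a _ hadj p =>
    refine ⟨a, hadj.symm, ?_⟩
    have h₁ := SimpleGraph.dist_le p
    have h₂ := hT.dist_triangle (u := r) (v := a) (w := b)
    rw [SimpleGraph.dist_eq_one_iff_adj.2 hadj.symm] at h₂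
    rw [SimpleGraph.Walk.length_cons] at hp
    rw [SimpleGraph.dist_comm (u := r), SimpleGraph.dist_comm (u := r)] at h₂ ⊢
    omega

end ParentFunction

/-! ### Lauritzen's construction and topological orders -/

section CliqueTrees

variable {V : Type*} {G : SimpleGraph V}

/-- Paths in a tree are unique, so shortcutting any walk inside the cliques containing `v` yields
the path itself. -/
theorem isCliqueTree_of_forall_exists_walk {T : SimpleGraph (MaximalClique G)} (hT : T.IsTree)
    (h : ∀ (C D : MaximalClique G), ∀ v ∈ C.1 ∩ D.1,
      ∃ p : T.Walk C D, ∀ E ∈ p.support, v ∈ E.1) : IsCliqueTree G T where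
  isTree := hT
  junction := by
    classical
    intro C D p hp E hE v hv
    obtain ⟨q, hq⟩ := h C D v hv
    rw [(hT.existsUnique_path C D).unique hp q.bypass_isPath] at hE
    exact hq E (q.support_bypass_subset_support hE)

theorem mem_separator {π : CliqueOrdering G} {k : Fin (Nat.card (MaximalClique G))} {v : V} :
    v ∈ separator π k ↔ (∃ j < k, v ∈ (π j).1) ∧ v ∈ (π k).1 := by
  simp [separator]

theorem isCliqueTree_parentGraph (π : CliqueOrdering G)
    {f : Fin (Nat.card (MaximalClique G)) → Fin (Nat.card (MaximalClique G))}
    (hn : 0 < Nat.card (MaximalClique G))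
    (hf : ∀ k, 0 < k.val → f k < k ∧ separator π k = (π (f k)).1 ∩ (π k).1) :
    IsCliqueTree G (parentGraph π f) := by
  have hf' : ∀ k, 0 < k.val → f k < k := fun k hk => (hf k hk).1
  have key : ∀ k, ∀ j < k, ∀ v ∈ (π j).1 ∩ (π k).1,
      ∃ p : (parentGraph π f).Walk (π j) (π k), ∀ E ∈ p.support, v ∈ E.1 := by
    intro k
    induction k using WellFoundedLT.induction with
    | ind k ih =>
      intro j hjk v hv
      have hk : 0 < k.val := (Nat.zero_le _).trans_lt (Fin.lt_def.1 hjk)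
      -- The common vertex lies in the separator, hence in the parent; the pair `j`, `f k` then has
      -- both positions below `k`.
      have hvf : v ∈ (π (f k)).1 := by
        have : v ∈ separator π k := mem_separator.2 ⟨⟨j, hjk, hv.1⟩, hv.2⟩
        rw [(hf k hk).2] at this
        exact this.1
      obtain ⟨p, hp⟩ : ∃ p : (parentGraph π f).Walk (π j) (π (f k)), ∀ E ∈ p.support, v ∈ E.1 := by
        rcases lt_trichotomy j (f k) with h | h | h
        · exact ih _ (hf' k hk) j h v ⟨hv.1, hvf⟩
        · rw [← h]
          exact ⟨.nil, by simpa using hv.1⟩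
        · obtain ⟨p, hp⟩ := ih _ hjk _ h v ⟨hvf, hv.1⟩
          exact ⟨p.reverse, by simpa using hp⟩
      refine ⟨p.concat (parentGraph_adj π hf' hk).symm, fun E hE => ?_⟩
      rw [SimpleGraph.Walk.support_concat, List.mem_append] at hE
      rcases hE with hE | hE
      · exact hp E hE
      · rw [List.mem_singleton.1 hE]
        exact hv.2
  refine isCliqueTree_of_forall_exists_walk (isTree_parentGraph π hn hf') fun C D v hv => ?_
  obtain ⟨i, rfl⟩ := π.surjective C
  obtain ⟨j, rfl⟩ := π.surjective D
  rcases lt_trichotomy i j with h | rfl | h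
  · exact key j i h v hv
  · exact ⟨.nil, by simpa using hv.1⟩
  · obtain ⟨p, hp⟩ := key i j h v hv.symm
    exact ⟨p.reverse, by simpa using hp⟩

theorem treeFromSequence_parentGraph (π : CliqueOrdering G)
    {f : Fin (Nat.card (MaximalClique G)) → Fin (Nat.card (MaximalClique G))}
    (hf : ∀ k, 0 < k.val → f k < k ∧ separator π k = (π (f k)).1 ∩ (π k).1) :
    TreeFromSequence π (parentGraph π f) :=
  ⟨f, hf, edgeSet_parentGraph π fun k hk => (hf k hk).1⟩

theorem IsPerfect.exists_parent {π : CliqueOrdering G} (h : IsPerfect π) :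
    ∃ f : Fin (Nat.card (MaximalClique G)) → Fin (Nat.card (MaximalClique G)),
      ∀ k, 0 < k.val → f k < k ∧ separator π k = (π (f k)).1 ∩ (π k).1 := by
  classical
  have key : ∀ k, ∃ j, 0 < k.val → j < k ∧ separator π k = (π j).1 ∩ (π k).1 := by
    intro k
    by_cases hk : 0 < k.val
    · obtain ⟨-, j, hjk, hj⟩ := h k hk
      refine ⟨j, fun _ => ⟨hjk, Set.Subset.antisymm (fun v hv => ⟨hj.1 hv, hv.2⟩) fun v hv => ?_⟩⟩
      exact mem_separator.2 ⟨⟨j, hjk, hv.1⟩, hv.2⟩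
    · exact ⟨k, fun h => absurd h hk⟩
  exact ⟨fun k => (key k).choose, fun k => (key k).choose_spec⟩

theorem isPerfect_of_parent {π : CliqueOrdering G}
    {f : Fin (Nat.card (MaximalClique G)) → Fin (Nat.card (MaximalClique G))}
    (hf : ∀ k, 0 < k.val → f k < k ∧ separator π k = (π (f k)).1 ∩ (π k).1) : IsPerfect π := by
  intro k hk
  obtain ⟨hlt, hsep⟩ := hf k hk
  refine ⟨(π k).2.1.subset (by rw [hsep]; exact Set.inter_subset_right), f k, hlt, ?_⟩
  rw [hsep]
  -- Strictness: distinct maximal cliques are never nested.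
  refine ⟨Set.inter_subset_left, fun h => hlt.ne (π.injective (Subtype.ext ?_))⟩
  have hsub : (π (f k)).1 ⊆ (π k).1 := fun v hv => (h hv).2
  exact ((π (f k)).2.eq_of_subset (π k).2.1 hsub)

theorem TreeFromSequence.isTopologicalOrder {T : SimpleGraph (MaximalClique G)}
    {π : CliqueOrdering G} (hn : 0 < Nat.card (MaximalClique G)) (hT : T.IsTree)
    (h : TreeFromSequence π T) : IsTopologicalOrder T π := by
  obtain ⟨f, hf, hE⟩ := h
  have hadj : ∀ k : Fin (Nat.card (MaximalClique G)), 0 < k.val → T.Adj (π k) (π (f k)) :=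
    fun k hk => by
      rw [← SimpleGraph.mem_edgeSet, hE]
      exact ⟨k, hk, rfl⟩
  refine ⟨⟨0, hn⟩, rfl, fun a b hab => ?_⟩
  have key : ∀ a b, DirectedEdge T (π ⟨0, hn⟩) a b → π.symm a < π.symm b := by
    rintro a b ⟨hadj', hdist⟩
    rw [← SimpleGraph.mem_edgeSet, hE] at hadj'
    obtain ⟨k, hk, hab⟩ := hadj'
    have hd := dist_eq_dist_parent_add_one hT (fun k hk => (hf k hk).1) hadj
      (j := ⟨0, hn⟩) (k := k) hk
    rcases Sym2.eq_iff.1 hab with ⟨rfl, rfl⟩ | ⟨rfl, rfl⟩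
    · omega
    · simpa using (hf k hk).1
  induction hab with
  | single h => exact key _ _ h
  | tail _ h ih => exact ih.trans (key _ _ h)

theorem IsCliqueTree.treeFromSequence {T : SimpleGraph (MaximalClique G)} (hT : IsCliqueTree G T)
    {π : CliqueOrdering G} {k₀ : Fin (Nat.card (MaximalClique G))} (h₀ : k₀.val = 0)
    (h : ∀ a b, DirectedEdge T (π k₀) a b → π.symm a < π.symm b) : TreeFromSequence π T := by
  have hn : 0 < Nat.card (MaximalClique G) := (Nat.zero_le _).trans_lt k₀.2
  have key : ∀ k : Fin (Nat.card (MaximalClique G)), ∃ j,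
      0 < k.val → DirectedEdge T (π k₀) (π j) (π k) := by
    intro k
    by_cases hk : 0 < k.val
    · obtain ⟨a, ha⟩ := exists_directedEdge hT.isTree.connected (r := π k₀) (b := π k)
        (fun h => by rw [π.injective h] at hk; omega)
      exact ⟨π.symm a, fun _ => by simpa using ha⟩
    · exact ⟨k, fun h => absurd h hk⟩
  choose f hf using key
  have hlt : ∀ k, 0 < k.val → f k < k := fun k hk => by simpa using h _ _ (hf k hk)
  have hadj : ∀ k, 0 < k.val → T.Adj (π k) (π (f k)) := fun k hk => (hf k hk).1.symm
  have hTf : parentGraph π f = T := by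
    refine IsTree.eq_of_le ?_ (isTree_parentGraph π hn hlt) hT.isTree
    rw [← SimpleGraph.edgeSet_subset_edgeSet, edgeSet_parentGraph π hlt]
    rintro _ ⟨k, hk, rfl⟩
    exact hadj k hk
  rw [← hTf]
  refine treeFromSequence_parentGraph π fun k hk => ⟨hlt k hk, Set.Subset.antisymm ?_ ?_⟩
  · intro v hv
    obtain ⟨⟨j, hjk, hvj⟩, hvk⟩ := mem_separator.1 hv
    obtain ⟨p, hp, hkp⟩ := exists_path_to_parent hlt hadj hjk
    refine ⟨hT.junction _ _ _ (hp.concat hkp (hadj k hk).symm) _ ?_ ⟨hvj, hvk⟩, hvk⟩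
    rw [SimpleGraph.Walk.support_concat, List.mem_append]
    exact .inl p.end_mem_support
  · exact fun v hv => mem_separator.2 ⟨⟨f k, hlt k hk, hv.1⟩, hv.2⟩

theorem TreeFromSequence.isPerfect {T : SimpleGraph (MaximalClique G)} {π : CliqueOrdering G}
    (h : TreeFromSequence π T) : IsPerfect π :=
  isPerfect_of_parent h.choose_spec.1

theorem treeFromSequence_iff_isTopologicalOrder {T : SimpleGraph (MaximalClique G)}
    {π : CliqueOrdering G} (hn : 0 < Nat.card (MaximalClique G)) (hT : IsCliqueTree G T) :
    TreeFromSequence π T ↔ IsTopologicalOrder T π := by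
  refine ⟨fun h => h.isTopologicalOrder hn hT.isTree, ?_⟩
  rintro ⟨k₀, h₀, h⟩
  exact hT.treeFromSequence h₀ fun a b hab => h a b (.single hab)

/-- Sorting by a key that increases along directed edges gives a topological order; the freedom in
`key` lets further cliques be forced early or late. -/
theorem IsCliqueTree.exists_treeFromSequence_of_key [Finite (MaximalClique G)] {α : Type*}
    [LinearOrder α] {T : SimpleGraph (MaximalClique G)} (hT : IsCliqueTree G T)
    (r : MaximalClique G) (key : MaximalClique G → α) (hr : ∀ c ≠ r, key r < key c)
    (hkey : ∀ a b, DirectedEdge T r a b → key a < key b) :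
    ∃ π : CliqueOrdering G, (π.symm r).val = 0 ∧ TreeFromSequence π T ∧
      ∀ a b, key a < key b → π.symm a < π.symm b := by
  obtain ⟨π, hπ⟩ := exists_equiv_monotone key
  have : Nonempty (MaximalClique G) := ⟨r⟩
  let k₀ : Fin (Nat.card (MaximalClique G)) := ⟨0, Nat.card_pos⟩
  have h₀ : π k₀ = r := by
    by_contra h
    have := hπ _ _ (hr _ h)
    rw [π.symm_apply_apply] at this
    exact absurd (Fin.lt_def.1 this) (Nat.not_lt_zero _)
  refine ⟨π, by simp [← h₀, k₀], hT.treeFromSequence (k₀ := k₀) rfl fun a b hab => ?_, hπ⟩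
  rw [h₀] at hab
  exact hπ _ _ (hkey _ _ hab)

end CliqueTrees

/-! ### Edge exchange between clique trees -/

section Exchange

variable {V : Type*} {G : SimpleGraph V}

theorem reachable_of_treeFromSequence {π : CliqueOrdering G} {T T' : CliqueTree G}
    (h : TreeFromSequence π T.1) (h' : TreeFromSequence π T'.1) :
    (bipartiteGraph G).Reachable (.inl T) (.inl T') := by
  let p : PerfectSequence G := ⟨π, h.isPerfect⟩
  have h₁ : (bipartiteGraph G).Adj (.inl T) (.inr p) := h
  have h₂ : (bipartiteGraph G).Adj (.inl T') (.inr p) := h'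
  exact h₁.reachable.trans h₂.symm.reachable

/-- Moving one end of an edge of a clique tree, without changing the two sides of the edge. -/
theorem exists_cliqueTree_move_edge [Finite (MaximalClique G)] (T : CliqueTree G)
    {A B A' : MaximalClique G} (hAB : T.1.Adj A B)
    (hA' : (T.1.deleteEdges {s(A, B)}).Reachable A A') (hsub : A.1 ∩ B.1 ⊆ A'.1) :
    ∃ T' : CliqueTree G, T'.1.edgeSet = insert s(A', B) (T.1.edgeSet \ {s(A, B)}) ∧
      A'.1 ∩ B.1 ⊆ A.1 ∧ (bipartiteGraph G).Reachable (.inl T) (.inl T') := by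
  classical
  obtain ⟨T, hT⟩ := T
  dsimp only at hAB hA' ⊢
  have hbr : ¬ (T.deleteEdges {s(A, B)}).Reachable A B :=
    SimpleGraph.isBridge_iff.1
      (SimpleGraph.isAcyclic_iff_forall_adj_isBridge.1 hT.isTree.isAcyclic hAB)
  let side : MaximalClique G → ℕ :=
    fun c => if (T.deleteEdges {s(A, B)}).Reachable B c then 1 else 0
  have hside : ∀ c, (T.deleteEdges {s(A, B)}).Reachable A c → side c = 0 :=
    fun c hc => if_neg fun h => hbr (hc.trans h.symm)
  have hsideB : side B = 1 := if_pos .rfl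
  -- The order starts at `A` and lists the whole side of `A` before the side of `B`. Hence `A'`
  -- precedes `B`, and `separator π (π.symm B) = A ∩ B` lets `A'` replace `A` as parent of `B`.
  obtain ⟨π, h₀, ⟨f, hf, hE⟩, hπ⟩ := hT.exists_treeFromSequence_of_key A
    (fun c => toLex (side c, T.dist A c))
    (fun c hc => by
      have := hT.isTree.connected.pos_dist_of_ne hc.symm
      rw [Prod.Lex.toLex_lt_toLex, hside A .rfl, SimpleGraph.dist_self]
      rcases Nat.eq_zero_or_pos (side c) with h | h
      · exact .inr ⟨h.symm, this⟩
      · exact .inl h)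
    (fun a b ⟨hab, hd⟩ => by
      have hle : side a ≤ side b := by
        by_cases ha : (T.deleteEdges {s(A, B)}).Reachable B a
        · have hb : (T.deleteEdges {s(A, B)}).Reachable B b := by
            refine ha.trans (SimpleGraph.Adj.reachable ?_)
            rw [SimpleGraph.deleteEdges_adj]
            refine ⟨hab, fun h => ?_⟩
            -- The only edge leaving the side of `B` leads to the root `A`, so it is not directed
            -- outwards.
            rcases Sym2.eq_iff.1 (Set.mem_singleton_iff.1 h) with ⟨rfl, rfl⟩ | ⟨rfl, rfl⟩
            · exact hbr ha.symm
            · rw [SimpleGraph.dist_self] at hd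
              omega
          simp [side, ha, hb]
        · simp [side, ha]
      rw [Prod.Lex.toLex_lt_toLex]
      rcases hle.lt_or_eq with h | h
      · exact .inl h
      · exact .inr ⟨h, by dsimp only; omega⟩)
  have hlt : π.symm A' < π.symm B := hπ _ _ (by
    rw [Prod.Lex.toLex_lt_toLex, hside A' hA', hsideB]
    exact .inl Nat.zero_lt_one)
  have hB : 0 < (π.symm B).val := (Nat.zero_le _).trans_lt (Fin.lt_def.1 hlt)
  have hpar : ∀ k : Fin (Nat.card (MaximalClique G)), 0 < k.val →
      (s(π k, π (f k)) = s(A, B) ↔ k = π.symm B) := by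
    obtain ⟨k₁, hk₁, he⟩ : s(A, B) ∈ {e | ∃ k, 0 < k.val ∧ e = s(π k, π (f k))} := hE ▸ hAB
    have hk : ∀ k : Fin (Nat.card (MaximalClique G)), 0 < k.val →
        s(π k, π (f k)) = s(A, B) → k = π.symm B := by
      intro k hk h
      rcases Sym2.eq_iff.1 h with ⟨h, -⟩ | ⟨h, -⟩
      · rw [← h, π.symm_apply_apply] at h₀
        omega
      · rw [← h, π.symm_apply_apply]
    refine fun k h => ⟨hk k h, ?_⟩
    rintro rfl
    rw [he, hk k₁ hk₁ he.symm]
  have hfB : π (f (π.symm B)) = A := by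
    have := (hpar _ hB).2 rfl
    rw [π.apply_symm_apply, Sym2.eq_swap] at this
    exact Sym2.congr_left.1 this
  have hsep : separator π (π.symm B) = A.1 ∩ B.1 := by
    rw [(hf _ hB).2, hfB, π.apply_symm_apply]
  have hsub' : A'.1 ∩ B.1 ⊆ A.1 := fun v hv => by
    have : v ∈ separator π (π.symm B) :=
      mem_separator.2 ⟨⟨_, hlt, by simpa using hv.1⟩, by simpa using hv.2⟩
    rw [hsep] at this
    exact this.1
  let g := Function.update f (π.symm B) (π.symm A')
  have hg : ∀ k, 0 < k.val → g k < k ∧ separator π k = (π (g k)).1 ∩ (π k).1 := by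
    intro k hk
    by_cases h : k = π.symm B
    · subst h
      simp only [g, Function.update_self, π.apply_symm_apply, hsep]
      exact ⟨hlt, Set.Subset.antisymm (fun v hv => ⟨hsub hv, hv.2⟩)
        fun v hv => ⟨hsub' hv, hv.2⟩⟩
    · simpa only [g, Function.update_of_ne h] using hf k hk
  have hn : 0 < Nat.card (MaximalClique G) := (Nat.zero_le _).trans_lt (π.symm B).2
  refine ⟨⟨parentGraph π g, isCliqueTree_parentGraph π hn hg⟩, ?_, hsub',
    reachable_of_treeFromSequence (π := π) ⟨f, hf, hE⟩ (treeFromSequence_parentGraph π hg)⟩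
  rw [edgeSet_parentGraph π fun k hk => (hg k hk).1, hE]
  ext x
  constructor
  · rintro ⟨k, hk, rfl⟩
    by_cases h : k = π.symm B
    · subst h
      left
      simp [g, Sym2.eq_swap]
    · right
      rw [show g k = f k from Function.update_of_ne h _ _]
      exact ⟨⟨k, hk, rfl⟩, fun h' => h ((hpar k hk).1 h')⟩
  · rintro (rfl | ⟨⟨k, hk, rfl⟩, hx⟩)
    · exact ⟨π.symm B, hB, by simp [g, Sym2.eq_swap]⟩
    · have h : k ≠ π.symm B := fun h => hx ((hpar k hk).2 h)
      exact ⟨k, hk, by rw [show g k = f k from Function.update_of_ne h _ _]⟩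

theorem IsPath.reachable_fst_of_mem_darts {W : Type*} {T : SimpleGraph W} {x y : W}
    {p : T.Walk x y} (hp : p.IsPath) {d : T.Dart} (hd : d ∈ p.darts) :
    (T.deleteEdges {d.edge}).Reachable x d.fst ∧ (T.deleteEdges {d.edge}).Reachable d.snd y := by
  induction p with
  | nil => simp at hd
  | @cons u v w h p ih =>
    have hnd := hp.isTrail.edges_nodup
    rw [SimpleGraph.Walk.edges_cons, List.nodup_cons] at hnd
    rw [SimpleGraph.Walk.darts_cons, List.mem_cons] at hd
    rcases hd with rfl | hd
    · exact ⟨.rfl, ⟨p.toDeleteEdge _ hnd.1⟩⟩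
    · obtain ⟨h₁, h₂⟩ := ih hp.of_cons hd
      refine ⟨SimpleGraph.Reachable.trans (SimpleGraph.Adj.reachable ?_) h₁, h₂⟩
      rw [SimpleGraph.deleteEdges_adj]
      refine ⟨h, fun h' => hnd.1 ?_⟩
      rw [Set.mem_singleton_iff.1 h']
      exact List.mem_map_of_mem hd

/-- The new edge `A'B'` comes from `T'`, while the edge `AB` given up is not in `T'`; so strictly
fewer edges of `T'` are missing. -/
theorem exists_cliqueTree_exchange [Finite (MaximalClique G)] (T T' : CliqueTree G)
    (h : ¬ T'.1 ≤ T.1) :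
    ∃ T₂ : CliqueTree G, T'.1.edgeSet \ T₂.1.edgeSet ⊂ T'.1.edgeSet \ T.1.edgeSet ∧
      (bipartiteGraph G).Reachable (.inl T) (.inl T₂) := by
  obtain ⟨A', B', hadj', hnadj⟩ : ∃ A' B', T'.1.Adj A' B' ∧ ¬ T.1.Adj A' B' := by
    by_contra! h'
    exact h (SimpleGraph.le_iff_adj.2 h')
  have hbr : ¬ (T'.1.deleteEdges {s(A', B')}).Reachable A' B' :=
    SimpleGraph.isBridge_iff.1
      (SimpleGraph.isAcyclic_iff_forall_adj_isBridge.1 T'.2.isTree.isAcyclic hadj')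
  obtain ⟨p, hp⟩ := T.2.isTree.connected.exists_isPath A' B'
  obtain ⟨⟨⟨A, B⟩, hAB⟩, hd, hA, hB⟩ := p.exists_boundary_dart
    {c | (T'.1.deleteEdges {s(A', B')}).Reachable A' c} SimpleGraph.Reachable.rfl hbr
  obtain ⟨hr₁, hr₂⟩ := IsPath.reachable_fst_of_mem_darts hp hd
  simp only [SimpleGraph.Dart.edge_mk, Set.mem_ofPred_eq] at hr₁ hr₂ hA hB
  replace hAB : T.1.Adj A B := hAB
  have hnot : ¬ T'.1.Adj A B := fun hAB' => by
    refine hB (hA.trans (SimpleGraph.Adj.reachable ?_))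
    rw [SimpleGraph.deleteEdges_adj]
    refine ⟨hAB', fun h' => ?_⟩
    rw [Set.mem_singleton_iff, Sym2.eq_iff] at h'
    rcases h' with ⟨rfl, rfl⟩ | ⟨rfl, rfl⟩
    · exact hnadj hAB
    · exact hnadj hAB.symm
  obtain ⟨q, hq⟩ := T'.2.isTree.connected.exists_isPath A B
  -- `A` and `B` are separated in `T' - A'B'`, so the junction property of `T'` gives `A ∩ B ⊆ A'`
  -- and `A ∩ B ⊆ B'`.
  have hmem : s(A', B') ∈ q.edges :=
    q.mem_edges_of_not_reachable_deleteEdges fun h' => hB (hA.trans h')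
  have hsubA := T'.2.junction A B q hq A' (q.fst_mem_support_of_mem_edges hmem)
  have hsubB := T'.2.junction A B q hq B' (q.snd_mem_support_of_mem_edges hmem)
  obtain ⟨T₁, hT₁, hsub, hreach₁⟩ := exists_cliqueTree_move_edge T hAB hr₁.symm hsubA
  have hbrT : ¬ (T.1.deleteEdges {s(A, B)}).Reachable A B :=
    SimpleGraph.isBridge_iff.1
      (SimpleGraph.isAcyclic_iff_forall_adj_isBridge.1 T.2.isTree.isAcyclic hAB)
  have hdel : T₁.1.edgeSet \ {s(A', B)} = T.1.edgeSet \ {s(A, B)} := by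
    rw [hT₁, Set.insert_sdiff_of_mem _ (Set.mem_singleton _), Set.sdiff_singleton_eq_self]
    intro h'
    rw [← SimpleGraph.edgeSet_deleteEdges] at h'
    exact hbrT (hr₁.symm.trans (SimpleGraph.Adj.reachable h'))
  have hdel' : T₁.1.deleteEdges {s(B, A')} = T.1.deleteEdges {s(A, B)} := by
    rw [← SimpleGraph.edgeSet_inj, SimpleGraph.edgeSet_deleteEdges,
      SimpleGraph.edgeSet_deleteEdges, ← hdel, Sym2.eq_swap]
  have hadj₁ : T₁.1.Adj B A' := by
    rw [SimpleGraph.adj_comm, ← SimpleGraph.mem_edgeSet, hT₁]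
    exact Set.mem_insert _ _
  -- Now `A'` is the fixed end. The inclusion `B ∩ A' ⊆ B'` follows from `A' ∩ B ⊆ A`, obtained in
  -- the first move.
  obtain ⟨T₂, hT₂, -, hreach₂⟩ := exists_cliqueTree_move_edge T₁ hadj₁ (A' := B')
    (by rw [hdel']; exact hr₂) fun v hv => hsubB ⟨hsub hv.symm, hv.1⟩
  refine ⟨T₂, ?_, hreach₁.trans hreach₂⟩
  have hT₂' : T₂.1.edgeSet = insert s(A', B') (T.1.edgeSet \ {s(A, B)}) := by
    rw [hT₂, Sym2.eq_swap, ← hdel, Sym2.eq_swap (a := B)]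
  rw [hT₂']
  refine ⟨?_, fun h' => ?_⟩
  · rintro x ⟨hx, hx'⟩
    refine ⟨hx, fun hxT => hx' (.inr ⟨hxT, ?_⟩)⟩
    rintro rfl
    exact hnot hx
  · exact (h' (a := s(A', B')) ⟨hadj', hnadj⟩).2 (.inl rfl)

theorem reachable_cliqueTree [Finite (MaximalClique G)] (T T' : CliqueTree G) :
    (bipartiteGraph G).Reachable (.inl T) (.inl T') := by
  induction hm : (T'.1.edgeSet \ T.1.edgeSet).ncard using Nat.strong_induction_on generalizing T with
  | _ m ih =>
    by_cases h : T'.1 ≤ T.1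
    · rw [Subtype.ext (IsTree.eq_of_le h T'.2.isTree T.2.isTree)]
    · obtain ⟨T₂, hlt, hr⟩ := exists_cliqueTree_exchange T T' h
      exact hr.trans (ih _ (hm ▸ Set.ncard_lt_ncard hlt (Set.toFinite _)) T₂ rfl)

theorem connected_bipartiteGraph [Finite (MaximalClique G)]
    (hn : 0 < Nat.card (MaximalClique G)) (π : PerfectSequence G) :
    (bipartiteGraph G).Connected := by
  have key : ∀ π : PerfectSequence G, ∃ T : CliqueTree G,
      (bipartiteGraph G).Reachable (.inl T) (.inr π) := fun π => by
    obtain ⟨f, hf⟩ := π.2.exists_parent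
    have h : (bipartiteGraph G).Adj
      (.inl ⟨parentGraph π.1 f, isCliqueTree_parentGraph π.1 hn hf⟩) (.inr π) :=
      treeFromSequence_parentGraph π.1 hf
    exact ⟨_, h.reachable⟩
  obtain ⟨T, -⟩ := key π
  have h : ∀ x, (bipartiteGraph G).Reachable (.inl T) x := by
    rintro (T' | π')
    · exact reachable_cliqueTree T T'
    · obtain ⟨T', hT'⟩ := key π'
      exact (reachable_cliqueTree T T').trans hT'
  exact { preconnected := fun x y => (h x).symm.trans (h y), nonempty := ⟨.inl T⟩ }

end Exchange

/-! ### Simplicial vertices of chordal graphs -/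

section Simplicial

variable {V : Type*} {G : SimpleGraph V}

/-- A chord would shorten a geodesic. -/
theorem mem_edges_of_length_eq_dist {H : SimpleGraph V} {x y u w : V} {p : H.Walk x y}
    (hp : p.length = H.dist x y) (hu : u ∈ p.support) (hw : w ∈ p.support) (h : H.Adj u w) :
    s(u, w) ∈ p.edges := by
  obtain ⟨i, rfl, hi⟩ := SimpleGraph.Walk.mem_support_iff_exists_getVert.1 hu
  obtain ⟨j, rfl, hj⟩ := SimpleGraph.Walk.mem_support_iff_exists_getVert.1 hw
  have key : ∀ {i j : ℕ}, i < j → j ≤ p.length → H.Adj (p.getVert i) (p.getVert j) →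
      s(p.getVert i, p.getVert j) ∈ p.edges := by
    intro i j hij hj h
    have hd := SimpleGraph.dist_le ((p.take i).append (.cons h (p.drop j)))
    rw [SimpleGraph.Walk.length_append, SimpleGraph.Walk.length_cons,
      SimpleGraph.Walk.take_length, SimpleGraph.Walk.drop_length, ← hp] at hd
    obtain rfl : j = i + 1 := by omega
    exact (p.mk_mem_edges_iff_exists).2 ⟨i, hj, rfl⟩
  rcases lt_trichotomy i j with hij | rfl | hij
  · exact key hij hj h
  · exact absurd rfl h.ne
  · rw [Sym2.eq_swap]
    exact key hij hi h.symm

/-- The graph obtained from `G` by deleting all edges which are not inside `W`. -/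
def restrict (G : SimpleGraph V) (W : Set V) : SimpleGraph V where
  Adj a b := G.Adj a b ∧ a ∈ W ∧ b ∈ W
  symm := ⟨fun _ _ h => ⟨h.1.symm, h.2.2, h.2.1⟩⟩
  loopless := ⟨fun _ h => h.1.ne rfl⟩

theorem mem_of_reachable_restrict {W : Set V} {x y : V} (hx : x ∈ W)
    (h : (restrict G W).Reachable x y) : y ∈ W := by
  rw [SimpleGraph.reachable_iff_reflTransGen] at h
  cases h with
  | refl => exact hx
  | tail _ h => exact h.2.2

theorem mem_of_mem_support_restrict {W : Set V} {x y z : V} (hx : x ∈ W)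
    {p : (restrict G W).Walk x y} (hz : z ∈ p.support) : z ∈ W := by
  classical
  exact mem_of_reachable_restrict hx ⟨p.takeUntil z hz⟩

/-- Otherwise a shortest `x`-`y` path in `W`, closed up through `v`, is a cycle of length at least
`4`; it has no chord inside the geodesic, and none at `v` by `hW`. -/
theorem IsChordal.adj_of_reachable_restrict (hG : IsChordal G) {v x y : V} {W : Set V}
    (hxy : x ≠ y) (hvx : G.Adj v x) (hvy : G.Adj v y) (hv : v ∉ W) (hx : x ∈ W)
    (hr : (restrict G W).Reachable x y) (hW : ∀ z ∈ W, z ≠ x → z ≠ y → ¬ G.Adj v z) :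
    G.Adj x y := by
  by_contra hadj
  obtain ⟨p, hp, hpd⟩ := hr.exists_path_of_dist
  have hle : restrict G W ≤ G := fun _ _ h => h.1
  have hmem : ∀ z ∈ p.support, z ∈ W := fun z hz => mem_of_mem_support_restrict hx hz
  have hvp : v ∉ (p.mapLe hle).support := by
    rw [SimpleGraph.Walk.support_mapLe_eq_support]
    exact fun h => hv (hmem v h)
  have hlen : 2 ≤ p.length := by
    have h₀ : p.length ≠ 0 := fun h => hxy (SimpleGraph.Walk.eq_of_length_eq_zero h)
    have h₁ : p.length ≠ 1 := fun h =>
      hadj (hle (SimpleGraph.dist_eq_one_iff_adj.1 (hpd.symm.trans h)))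
    omega
  let c : G.Walk v v := .cons hvx ((p.mapLe hle).concat hvy.symm)
  have hedges : c.edges = s(v, x) :: (p.edges ++ [s(y, v)]) := by
    simp [c, SimpleGraph.Walk.edges_concat]
  have hc : c.IsCycle := by
    refine (SimpleGraph.Walk.cons_isCycle_iff _ _).2 ⟨(hp.mapLe hle).concat hvp _, fun h => ?_⟩
    rw [SimpleGraph.Walk.edges_concat, List.concat_eq_append, List.mem_append] at h
    rcases h with h | h
    · exact hvp (SimpleGraph.Walk.fst_mem_support_of_mem_edges _ h)
    · rw [List.mem_singleton, Sym2.eq_swap] at h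
      exact hxy (Sym2.congr_left.1 h)
  have hsupp : ∀ z ∈ c.support, z = v ∨ z ∈ p.support := by
    intro z hz
    simp only [c, SimpleGraph.Walk.support_cons, SimpleGraph.Walk.support_concat,
      SimpleGraph.Walk.support_mapLe_eq_support, List.mem_cons, List.mem_append,
      List.not_mem_nil, or_false] at hz
    tauto
  have hstar : ∀ b ∈ p.support, G.Adj v b → s(v, b) ∈ c.edges := by
    intro b hb hvb
    rw [hedges]
    by_cases hbx : b = x
    · simp [hbx]
    by_cases hby : b = y
    · simp [hby, Sym2.eq_swap]
    · exact absurd hvb (hW b (hmem b hb) hbx hby)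
  obtain ⟨a, ha, b, hb, hab, hn⟩ := hG c hc (by simp [c]; omega)
  rcases hsupp a ha with rfl | ha' <;> rcases hsupp b hb with rfl | hb'
  · exact hab.ne rfl
  · exact hn (hstar b hb' hab)
  · exact hn (Sym2.eq_swap ▸ hstar a ha' hab.symm)
  · have := mem_edges_of_length_eq_dist hpd ha' hb' ⟨hab, hmem a ha', hmem b hb'⟩
    rw [hedges] at hn
    exact hn (List.mem_cons_of_mem _ (List.mem_append_left _ this))

/-- Dirac's argument. `D` is a component of the non-neighbours of `v` in `U`, and `S` is its
boundary, a clique. Vertices of `D` have all their `U`-neighbours in `D ∪ S`, so a vertex of `D`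
simplicial in the smaller set `D ∪ S` is simplicial in `U`. -/
theorem IsChordal.exists_simplicial_not_adj [Finite V] (hG : IsChordal G) (U : Set V) (v : V)
    (hv : v ∈ U) (hw : ∃ w ∈ U, w ≠ v ∧ ¬ G.Adj v w) :
    ∃ s ∈ U, s ≠ v ∧ ¬ G.Adj v s ∧ G.IsClique {z ∈ U | G.Adj s z} := by
  induction U using WellFoundedLT.induction generalizing v with
  | ind U ih =>
    obtain ⟨w, hwU, hwv, hvw⟩ := hw
    let Z : Set V := {z ∈ U | z ≠ v ∧ ¬ G.Adj v z}
    have hwZ : w ∈ Z := ⟨hwU, hwv, hvw⟩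
    let D : Set V := {z | (restrict G Z).Reachable w z}
    have hwD : w ∈ D := SimpleGraph.Reachable.rfl
    have hDZ : D ⊆ Z := fun z hz => mem_of_reachable_restrict hwZ hz
    let S : Set V := {x ∈ U | G.Adj v x ∧ ∃ d ∈ D, G.Adj x d}
    have hN : ∀ d ∈ D, ∀ z ∈ U, G.Adj d z → z ∈ D ∪ S := by
      intro d hd z hz hdz
      by_cases hvz : G.Adj v z
      · exact .inr ⟨hz, hvz, d, hd, hdz.symm⟩
      · have hzv : z ≠ v := by
          rintro rfl
          exact (hDZ hd).2.2 hdz.symm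
        have h : (restrict G Z).Adj d z := ⟨hdz, hDZ hd, hz, hzv, hvz⟩
        exact .inl (SimpleGraph.Reachable.trans hd h.reachable)
    have hS : G.IsClique S := by
      rintro x ⟨hxU, hvx, d₁, hd₁, hxd₁⟩ y ⟨hyU, hvy, d₂, hd₂, hyd₂⟩ hxy
      let W : Set V := D ∪ {x, y}
      have hxW : x ∈ W := .inr (.inl rfl)
      have hyW : y ∈ W := .inr (.inr rfl)
      have hvW : v ∉ W := by
        rintro (h | rfl | rfl)
        · exact (hDZ h).2.1 rfl
        · exact hvx.ne rfl
        · exact hvy.ne rfl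
      have hDW : ∀ d ∈ D, (restrict G W).Reachable w d := by
        intro d hd
        have hd' := (SimpleGraph.reachable_iff_reflTransGen _ _).1 hd
        induction hd' with
        | refl => exact .rfl
        | @tail a b hwa hab ih' =>
          have ha : a ∈ D := (SimpleGraph.reachable_iff_reflTransGen _ _).2 hwa
          have h : (restrict G W).Adj a b := ⟨hab.1, .inl ha, .inl hd⟩
          exact (ih' ha).trans h.reachable
      have h₁ : (restrict G W).Adj x d₁ := ⟨hxd₁, hxW, .inl hd₁⟩
      have h₂ : (restrict G W).Adj y d₂ := ⟨hyd₂, hyW, .inl hd₂⟩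
      refine hG.adj_of_reachable_restrict hxy hvx hvy hvW hxW
        (((h₁.reachable.trans (hDW _ hd₁).symm).trans (hDW _ hd₂)).trans h₂.symm.reachable) ?_
      rintro z (hz | rfl | rfl) hzx hzy
      · exact (hDZ hz).2.2
      · exact absurd rfl hzx
      · exact absurd rfl hzy
    have hlt : D ∪ S < U := by
      refine ⟨Set.union_subset (fun z hz => (hDZ hz).1) fun z hz => hz.1, fun h => ?_⟩
      rcases h hv with h | h
      · exact (hDZ h).2.1 rfl
      · exact h.2.1.ne rfl
    -- Non-adjacency to the chosen vertex keeps `s` out of `S`: either that vertex is in the clique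
    -- `S`, or all of `S` is adjacent to everything. If neither case occurs, `D ∪ S` is a clique.
    obtain ⟨s, hs, hcl⟩ : ∃ s ∈ D, G.IsClique {z ∈ D ∪ S | G.Adj s z} := by
      by_cases hSu : ∃ x ∈ S, ∃ z ∈ D ∪ S, z ≠ x ∧ ¬ G.Adj x z
      · obtain ⟨x, hx, hz⟩ := hSu
        obtain ⟨s, hs, hsx, hxs, hcl⟩ := ih _ hlt x (.inr hx) hz
        exact ⟨s, hs.resolve_right fun h => hxs (hS hx h hsx.symm), hcl⟩
      push Not at hSu
      by_cases hDu : ∃ d ∈ D, ∃ z ∈ D ∪ S, z ≠ d ∧ ¬ G.Adj d z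
      · obtain ⟨d, hd, hz⟩ := hDu
        obtain ⟨s, hs, hsd, hds, hcl⟩ := ih _ hlt d (.inl hd) hz
        exact ⟨s, hs.resolve_right fun h => hds (hSu s h d (.inl hd) hsd.symm).symm, hcl⟩
      push Not at hDu
      refine ⟨w, hwD, ?_⟩
      rintro x ⟨hx, -⟩ y ⟨hy, -⟩ hxy
      exact hx.elim (fun h => hDu x h y hy hxy.symm) fun h => hSu x h y hy hxy.symm
    obtain ⟨hsU, hsv, hvs⟩ := hDZ hs
    have hsub : {z ∈ U | G.Adj s z} ⊆ {z ∈ D ∪ S | G.Adj s z} :=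
      fun z hz => ⟨hN s hs z hz.1 hz.2, hz.2⟩
    exact ⟨s, hsU, hsv, hvs, hcl.subset hsub⟩

theorem IsChordal.exists_simplicial [Finite V] (hG : IsChordal G) {U : Set V}
    (hU : U.Nonempty) : ∃ s ∈ U, G.IsClique {z ∈ U | G.Adj s z} := by
  by_cases h : G.IsClique U
  · exact ⟨_, hU.some_mem, h.subset (Set.sep_subset _ _)⟩
  · obtain ⟨v, hv, w, hw, hne, hvw⟩ : ∃ v ∈ U, ∃ w ∈ U, v ≠ w ∧ ¬ G.Adj v w := by
      by_contra! h'
      exact h h'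
    obtain ⟨s, hs, -, -, hcl⟩ := hG.exists_simplicial_not_adj U v hv ⟨w, hw, hne.symm, hvw⟩
    exact ⟨s, hs, hcl⟩

end Simplicial

/-! ### Existence of a perfect sequence -/

section RunningIntersection

variable {V : Type*} {G : SimpleGraph V}

/-- The maximal cliques of the subgraph of `G` induced by `U`. -/
def IsMaximalCliqueIn (G : SimpleGraph V) (U C : Set V) : Prop :=
  Maximal (fun C => G.IsClique C ∧ C ⊆ U) C

/-- `c 0, …, c (n - 1)` lists the maximal cliques of the subgraph induced by `U` and has the
running intersection property. -/
structure IsRunningIntersection (G : SimpleGraph V) (U : Set V) (n : ℕ) (c : ℕ → Set V) :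
    Prop where
  maximal_iff : ∀ C, IsMaximalCliqueIn G U C ↔ ∃ k < n, c k = C
  injOn : ∀ i < n, ∀ j < n, c i = c j → i = j
  exists_parent : ∀ k < n, 0 < k → ∃ j < k, ∀ i < k, c i ∩ c k ⊆ c j

/-- A simplicial vertex lies in exactly one maximal clique, its closed neighbourhood; adding `s` can
destroy the maximality of `N` only. -/
theorem isMaximalCliqueIn_iff_of_simplicial {U : Set V} {s : V} (hs : s ∈ U)
    (hcl : G.IsClique {z ∈ U | G.Adj s z}) (C : Set V) :
    IsMaximalCliqueIn G U C ↔ C = insert s {z ∈ U | G.Adj s z} ∨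
      IsMaximalCliqueIn G (U \ {s}) C ∧ C ≠ {z ∈ U | G.Adj s z} := by
  set N := {z ∈ U | G.Adj s z} with hN
  have hNU : N ⊆ U \ {s} := fun z hz => ⟨hz.1, fun h => hz.2.ne' h⟩
  have h₀ : G.IsClique (insert s N) ∧ insert s N ⊆ U :=
    ⟨hcl.insert fun b hb _ => hb.2, Set.insert_subset hs fun z hz => hz.1⟩
  have hsub : ∀ C, G.IsClique C → C ⊆ U → s ∈ C → C ⊆ insert s N := by
    intro C hC hCU hsC z hz
    by_cases h : z = s
    · exact .inl h
    · exact .inr ⟨hCU hz, hC hsC hz (Ne.symm h)⟩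
  have h₁ : IsMaximalCliqueIn G U (insert s N) :=
    ⟨h₀, fun C hC hle => hsub C hC.1 hC.2 (hle (.inl rfl))⟩
  constructor
  · intro h
    by_cases hsC : s ∈ C
    · exact .inl (h.eq_of_subset h₀ (hsub C h.1.1 h.1.2 hsC))
    · refine .inr ⟨⟨⟨h.1.1, fun z hz => ⟨h.1.2 hz, ?_⟩⟩, ?_⟩, ?_⟩
      · rintro rfl
        exact hsC hz
      · exact fun D hD hle => h.2 ⟨hD.1, hD.2.trans Set.sdiff_subset⟩ hle
      · rintro rfl
        exact hsC (h.2 h₀ (Set.subset_insert _ _) (.inl rfl))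
  · rintro (rfl | ⟨h, hne⟩)
    · exact h₁
    · refine ⟨⟨h.1.1, h.1.2.trans Set.sdiff_subset⟩, fun D hD hle => ?_⟩
      by_cases hsD : s ∈ D
      · refine absurd (h.eq_of_subset ⟨hcl, hNU⟩ fun z hz => ?_) hne
        exact (hsub D hD.1 hD.2 hsD (hle hz)).resolve_left (h.1.2 hz).2
      · exact h.2 ⟨hD.1, fun z hz => ⟨hD.2 hz, fun h => hsD (Set.mem_singleton_iff.1 h ▸ hz)⟩⟩ hle

theorem IsChordal.exists_isRunningIntersection [Finite V] (hG : IsChordal G) (U : Set V) :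
    ∃ n c, IsRunningIntersection G U n c := by
  classical
  induction U using WellFoundedLT.induction with
  | ind U ih =>
    rcases U.eq_empty_or_nonempty with rfl | hU
    -- The empty graph has one maximal clique, the empty set, so the list has length `1`.
    · refine ⟨1, fun _ => ∅, fun C => ⟨fun h => ⟨0, Nat.one_pos, ?_⟩, ?_⟩, fun i hi j hj _ => ?_,
        fun k hk h => ?_⟩
      · exact (Set.subset_empty_iff.1 h.1.2).symm
      · rintro ⟨-, -, rfl⟩
        exact ⟨⟨by simp, subset_rfl⟩, fun D hD _ => hD.2⟩
      · omega
      · omega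
    obtain ⟨s, hs, hcl⟩ := hG.exists_simplicial hU
    have hmax := isMaximalCliqueIn_iff_of_simplicial hs hcl
    set N := {z ∈ U | G.Adj s z} with hN
    have hNU : N ⊆ U \ {s} := fun z hz => ⟨hz.1, fun h => hz.2.ne' h⟩
    obtain ⟨n, c, hc⟩ := ih (U \ {s}) (Set.sdiff_singleton_ssubset.2 hs)
    have hmem : ∀ k < n, s ∉ c k := fun k hk h =>
      (((hc.maximal_iff _).2 ⟨k, hk, rfl⟩).1.2 h).2 rfl
    -- If `N` is already listed, it is enlarged by `s` in place: `s` lies in no other clique, so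
    -- intersections are unchanged. Otherwise `insert s N` is appended, with a listed clique
    -- containing `N` as parent.
    by_cases hNm : IsMaximalCliqueIn G (U \ {s}) N
    · obtain ⟨m, hm, hmN⟩ := (hc.maximal_iff N).1 hNm
      have hmem' : ∀ k < n, ∀ z, z ≠ s →
          (z ∈ Function.update c m (insert s N) k ↔ z ∈ c k) := by
        intro k hk z hz
        by_cases h : k = m
        · subst h
          simp [hmN, hz]
        · rw [Function.update_of_ne h]
      have hs' : ∀ k < n, s ∈ Function.update c m (insert s N) k → k = m := by
        intro k hk h
        by_contra hkm
        rw [Function.update_of_ne hkm] at h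
        exact hmem k hk h
      refine ⟨n, Function.update c m (insert s N), fun C => ?_, fun i hi j hj hij => ?_,
        fun k hk h => ?_⟩
      · rw [hmax]
        constructor
        · rintro (rfl | ⟨h, hne⟩)
          · exact ⟨m, hm, Function.update_self ..⟩
          · obtain ⟨k, hk, rfl⟩ := (hc.maximal_iff C).1 h
            refine ⟨k, hk, Function.update_of_ne ?_ _ _⟩
            rintro rfl
            exact hne hmN
        · rintro ⟨k, hk, rfl⟩
          by_cases h : k = m
          · subst h
            exact .inl (Function.update_self ..)
          · rw [Function.update_of_ne h]
            exact .inr ⟨(hc.maximal_iff _).2 ⟨k, hk, rfl⟩,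
              fun h' => h (hc.injOn k hk m hm (h'.trans hmN.symm))⟩
      · refine hc.injOn i hi j hj (Set.ext fun z => ?_)
        by_cases hz : z = s
        · rw [hz]
          exact iff_of_false (hmem i hi) (hmem j hj)
        · rw [← hmem' i hi z hz, ← hmem' j hj z hz, hij]
      · obtain ⟨j, hjk, hj⟩ := hc.exists_parent k hk h
        refine ⟨j, hjk, fun i hik z hz => ?_⟩
        by_cases hzs : z = s
        · subst hzs
          exact absurd ((hs' i (hik.trans hk) hz.1).trans (hs' k hk hz.2).symm) hik.ne
        · rw [hmem' j (hjk.trans hk) z hzs]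
          exact hj i hik ⟨(hmem' i (hik.trans hk) z hzs).1 hz.1, (hmem' k hk z hzs).1 hz.2⟩
    · have hlt : ∀ k < n, Function.update c n (insert s N) k = c k :=
        fun k hk => Function.update_of_ne hk.ne _ _
      have hself : Function.update c n (insert s N) n = insert s N := Function.update_self ..
      refine ⟨n + 1, Function.update c n (insert s N), fun C => ?_, fun i hi j hj hij => ?_,
        fun k hk h => ?_⟩
      · rw [hmax]
        constructor
        · rintro (rfl | ⟨h, -⟩)
          · exact ⟨n, n.lt_succ_self, hself⟩
          · obtain ⟨k, hk, rfl⟩ := (hc.maximal_iff C).1 h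
            exact ⟨k, hk.trans n.lt_succ_self, hlt k hk⟩
        · rintro ⟨k, hk, rfl⟩
          rcases (Nat.lt_succ_iff.1 hk).lt_or_eq with hk | rfl
          · rw [hlt k hk]
            have := (hc.maximal_iff _).2 ⟨k, hk, rfl⟩
            exact .inr ⟨this, fun h => hNm (h ▸ this)⟩
          · exact .inl hself
      · rcases (Nat.lt_succ_iff.1 hi).lt_or_eq with hi | rfl <;>
          rcases (Nat.lt_succ_iff.1 hj).lt_or_eq with hj | rfl
        · rw [hlt i hi, hlt j hj] at hij
          exact hc.injOn i hi j hj hij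
        · rw [hlt i hi, hself] at hij
          exact absurd (hij ▸ Set.mem_insert s N) (hmem i hi)
        · rw [hlt j hj, hself] at hij
          exact absurd (hij ▸ Set.mem_insert s N) (hmem j hj)
        · rfl
      · rcases (Nat.lt_succ_iff.1 hk).lt_or_eq with hk | rfl
        · obtain ⟨j, hjk, hj⟩ := hc.exists_parent k hk h
          refine ⟨j, hjk, fun i hik => ?_⟩
          rw [hlt i (hik.trans hk), hlt k hk, hlt j (hjk.trans hk)]
          exact hj i hik
        · obtain ⟨M, hNM, hM⟩ := (Set.toFinite {C | G.IsClique C ∧ C ⊆ U \ {s}}).exists_le_maximal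
            (a := N) ⟨hcl, hNU⟩
          obtain ⟨j, hj, rfl⟩ := (hc.maximal_iff M).1 hM
          refine ⟨j, hj, fun i hi z hz => ?_⟩
          rw [hlt i hi, hself] at hz
          rw [hlt j hj]
          exact hNM (hz.2.resolve_left fun h => hmem i hi (h ▸ hz.1))

theorem IsChordal.exists_isPerfect [Finite V] (hG : IsChordal G) :
    ∃ π : CliqueOrdering G, IsPerfect π := by
  obtain ⟨n, c, hc⟩ := hG.exists_isRunningIntersection Set.univ
  have hmax : ∀ C, Maximal G.IsClique C ↔ ∃ k < n, c k = C := fun C => by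
    rw [← hc.maximal_iff, IsMaximalCliqueIn]
    simp
  let e : Fin n ≃ MaximalClique G := Equiv.ofBijective
    (fun k => ⟨c k, (hmax _).2 ⟨k, k.2, rfl⟩⟩)
    ⟨fun i j h => Fin.ext (hc.injOn i i.2 j j.2 (congrArg Subtype.val h)), fun C => by
      obtain ⟨k, hk, h⟩ := (hmax C.1).1 C.2
      exact ⟨⟨k, hk⟩, Subtype.ext h⟩⟩
  have he : ∀ k, (e k).1 = c k := fun _ => rfl
  clear_value e
  have hn : n = Nat.card (MaximalClique G) := by rw [← Nat.card_congr e, Nat.card_fin]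
  subst hn
  have key : ∀ k : Fin (Nat.card (MaximalClique G)), ∃ j,
      0 < k.val → j < k ∧ separator e k = (e j).1 ∩ (e k).1 := by
    intro k
    by_cases hk : 0 < k.val
    · obtain ⟨j, hjk, hj⟩ := hc.exists_parent k k.2 hk
      refine ⟨⟨j, hjk.trans k.2⟩, fun _ => ⟨hjk, Set.Subset.antisymm (fun v hv => ?_)
        fun v hv => mem_separator.2 ⟨⟨_, hjk, hv.1⟩, hv.2⟩⟩⟩
      obtain ⟨⟨i, hik, hvi⟩, hvk⟩ := mem_separator.1 hv
      refine ⟨?_, hvk⟩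
      rw [he] at hvi hvk ⊢
      exact hj i hik ⟨hvi, hvk⟩
    · exact ⟨k, fun h => absurd h hk⟩
  choose f hf using key
  exact ⟨e, isPerfect_of_parent hf⟩

end RunningIntersection

end ChordalCliques

theorem mainTheorem1 {V : Type*} [Finite V] (G : SimpleGraph V)
    (hconn : G.Connected) (hchordal : ChordalCliques.IsChordal G) :
    (ChordalCliques.bipartiteGraph G).Connected ∧
      ∀ (T : ChordalCliques.CliqueTree G) (π : ChordalCliques.PerfectSequence G),
        (ChordalCliques.bipartiteGraph G).Adj (Sum.inl T) (Sum.inr π) ↔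
          ChordalCliques.IsTopologicalOrder T.1 π.1 := by
  obtain ⟨C, -, hC⟩ := (Set.toFinite {C | G.IsClique C}).exists_le_maximal (a := ∅)
    (by simp)
  have : Nonempty (ChordalCliques.MaximalClique G) := ⟨⟨C, hC⟩⟩
  have hn : 0 < Nat.card (ChordalCliques.MaximalClique G) := Nat.card_pos
  obtain ⟨π, hπ⟩ := hchordal.exists_isPerfect
  exact ⟨ChordalCliques.connected_bipartiteGraph hn ⟨π, hπ⟩, fun T π =>
    ChordalCliques.treeFromSequence_iff_isTopologicalOrder hn T.2⟩
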